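/- Fix a countable set $\mathcal V$ of propositional variables. A literal is a variable $q$ or its negation $\neg q$, and modal formulas are built from literals and the constants $\bot,\top$ using $\wedge,\vee,\Diamond,\Box$; negation of a formula is defined by the duality laws, $\varphi\to\psi$ is $\neg\varphi\vee\psi$, and $\varphi\leftrightarrow\psi$ is $(\varphi\to\psi)\wedge(\psi\to\varphi)$. For a finite tuple of variables $\vec p=(p_i)_{i<n}$, a formula is $\vec p$-positive if no literal $\neg p_i$ occurs in it. Let $\mathcal F=(W,R)$ be a finite Kripke frame. A model on $\mathcal F$ is a pair $(\mathcal F,\vartheta)$ with a valuation $\vartheta:\mathcal V\to\mathcal P(W)$; it is extended to all formulas in the usual way, with $\vartheta(\Diamond\varphi)=R^{-1}\vartheta(\varphi)$ and $\vartheta(\Box\varphi)=W\setminus R^{-1}(W\setminus\vartheta(\varphi))$. The logic $\Lambda=\mathrm{Log}\,\mathcal F$ is the set of all formulas $\varphi$ such that $\vartheta(\varphi)=W$ for every valuation $\vartheta$; formulas $\varphi,\psi$ are $\Lambda$-equivalent if $(\varphi\leftrightarrow\psi)\in\Lambda$. For a relation $Z\subseteq W\times W$ and $X\subseteq W$, let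 $Z(X)=\{w' : \exists w\in X,\ w\mathrel Z w'\}$ and $Z^{-1}(X)=\{w : \exists w'\in X,\ w\mathrel Z w'\}$. Then $Z$ is a $\vec p$-directed bisimulation between the models $(\mathcal F,\vartheta_1)$ and $(\mathcal F,\vartheta_2)$ if $Z(R^{-1}X)\subseteq R^{-1}Z(X)$ and $Z^{-1}(R^{-1}X)\subseteq R^{-1}Z^{-1}(X)$ for all $X\subseteq W$, and $Z(\vartheta_1(l))\subseteq\vartheta_2(l)$ for every literal $l\notin\{\neg p_i : i<n\}$. The relation $Z$ preserves $\varphi$ if $Z(\vartheta_1(\varphi))\subseteq\vartheta_2(\varphi)$. Corollary. Let $\mathcal F$ be a finite Kripke frame, $\Lambda=\mathrm{Log}\,\mathcal F$, $\vec p$ a finite tuple of variables and $\varphi$ a modal formula. Then $\varphi$ is $\Lambda$-equivalent to a $\vec p$-positive formula if and only if, for all valuations $\vartheta_1,\vartheta_2$ on $\mathcal F$, every $\vec p$-directed bisimulation between $(\mathcal F,\vartheta_1)$ and $(\mathcal F,\vartheta_2)$ preserves $\varphi$. -/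

import Mathlib

namespace PosModal

universe u v

/-- Literals over a set `V` of variables: `pos p` is `p`, and `neg p` is `¬p`. -/
inductive Literal (V : Type u) : Type u
  | pos (p : V)
  | neg (p : V)

/-- Negation of a literal, with `¬¬p = p`. -/
def Literal.compl {V : Type u} : Literal V → Literal V
  | .pos p => .neg p
  | .neg p => .pos p

/-- Modal formulas in negation normal form, built from literals and constants. -/
inductive Fm (V : Type u) : Type u
  | lit (l : Literal V)
  | bot
  | top
  | and (φ ψ : Fm V)
  | or (φ ψ : Fm V)
  | dia (φ : Fm V)
  | box (φ : Fm V)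

namespace Fm

variable {V : Type u}

/-- Negation of a formula, defined by the duality laws. -/
def neg : Fm V → Fm V
  | lit l => lit l.compl
  | bot => top
  | top => bot
  | and φ ψ => or φ.neg ψ.neg
  | or φ ψ => and φ.neg ψ.neg
  | dia φ => box φ.neg
  | box φ => dia φ.neg

/-- Implication `φ → ψ`, i.e. `¬φ ∨ ψ`. -/
def imp (φ ψ : Fm V) : Fm V := or φ.neg ψ

/-- The biconditional `φ ↔ ψ`. -/
def iff (φ ψ : Fm V) : Fm V := and (φ.imp ψ) (ψ.imp φ)

/-- The set of literals that occur in a formula. -/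
def lits : Fm V → Set (Literal V)
  | lit l => {l}
  | bot => ∅
  | top => ∅
  | and φ ψ => φ.lits ∪ ψ.lits
  | or φ ψ => φ.lits ∪ ψ.lits
  | dia φ => φ.lits
  | box φ => φ.lits

end Fm

/-- The set `¬P` of the negations of the variables from `P`. -/
def negLits {V : Type u} (P : Set V) : Set (Literal V) := Literal.neg '' P

/-- A formula is `P`-positive if no negation of a variable from `P` occurs in it. -/
def Fm.IsPositive {V : Type u} (P : Set V) (φ : Fm V) : Prop := φ.lits ∩ negLits P = ∅

/-- A formula is equivalent to another one in a set `Λ` of formulas (a logic). -/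
def EquivIn {V : Type u} (Λ : Set (Fm V)) (φ ψ : Fm V) : Prop := φ.iff ψ ∈ Λ

/-- A neighborhood frame on the set `W` of worlds: an arbitrary operator on the subsets of `W`. -/
structure NbhdFrame (W : Type v) where
  dia : Set W → Set W

/-- The dual operator of the frame. -/
def NbhdFrame.box {W : Type v} (F : NbhdFrame W) (X : Set W) : Set W := (F.dia Xᶜ)ᶜ

/-- A valuation of the variables in the subsets of `W`. -/
abbrev Valuation (V : Type u) (W : Type v) := V → Set W

/-- The value of a literal. -/
def Valuation.litVal {V : Type u} {W : Type v} (θ : Valuation V W) : Literal V → Set W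
  | .pos p => θ p
  | .neg p => (θ p)ᶜ

/-- The value of a formula in the model `(F, θ)`: the set of the worlds at which it is true. -/
def NbhdFrame.val {V : Type u} {W : Type v} (F : NbhdFrame W) (θ : Valuation V W) :
    Fm V → Set W
  | .lit l => θ.litVal l
  | .bot => ∅
  | .top => Set.univ
  | .and φ ψ => F.val θ φ ∩ F.val θ ψ
  | .or φ ψ => F.val θ φ ∪ F.val θ ψ
  | .dia φ => F.dia (F.val θ φ)
  | .box φ => F.box (F.val θ φ)

/-- The logic of a frame: the set of the formulas that are true at all worlds of all models
on it. -/
def NbhdFrame.log {W : Type v} (F : NbhdFrame W) (V : Type u) : Set (Fm V) :=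
  {φ | ∀ θ : Valuation V W, F.val θ φ = Set.univ}

/-- Bisimulations between frames (the notion is used for frames with monotone operators). -/
structure NbhdFrame.IsBisim {W₁ W₂ : Type v} (F₁ : NbhdFrame W₁) (F₂ : NbhdFrame W₂)
    (Z : SetRel W₁ W₂) : Prop where
  zig : ∀ X₁ : Set W₁, Z.image (F₁.dia X₁) ⊆ F₂.dia (Z.image X₁)
  zag : ∀ X₂ : Set W₂, Z.preimage (F₂.dia X₂) ⊆ F₁.dia (Z.preimage X₂)

/-- `τ`-bisimulations between the models `(F₁, θ₁)` and `(F₂, θ₂)`, for a set `τ` of literals. -/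
structure NbhdFrame.IsLitBisim {V : Type u} {W₁ W₂ : Type v} (τ : Set (Literal V))
    (F₁ : NbhdFrame W₁) (θ₁ : Valuation V W₁) (F₂ : NbhdFrame W₂) (θ₂ : Valuation V W₂)
    (Z : SetRel W₁ W₂) : Prop extends NbhdFrame.IsBisim F₁ F₂ Z where
  lit : ∀ l ∈ τ, Z.image (θ₁.litVal l) ⊆ θ₂.litVal l

/-- `P`-directed bisimulations: `τ`-bisimulations where `τ` consists of all literals except the
negations of the variables from `P`. -/
def NbhdFrame.IsDirectedBisim {V : Type u} {W₁ W₂ : Type v} (P : Set V)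
    (F₁ : NbhdFrame W₁) (θ₁ : Valuation V W₁) (F₂ : NbhdFrame W₂) (θ₂ : Valuation V W₂)
    (Z : SetRel W₁ W₂) : Prop :=
  NbhdFrame.IsLitBisim (Set.univ \ negLits P) F₁ θ₁ F₂ θ₂ Z

/-- The relation `Z` between the worlds of two models preserves the formula `φ`. -/
def NbhdFrame.Preserves {V : Type u} {W₁ W₂ : Type v}
    (F₁ : NbhdFrame W₁) (θ₁ : Valuation V W₁) (F₂ : NbhdFrame W₂) (θ₂ : Valuation V W₂)
    (Z : SetRel W₁ W₂) (φ : Fm V) : Prop :=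
  Z.image (F₁.val θ₁ φ) ⊆ F₂.val θ₂ φ

/-- A Kripke frame on the set `W` of worlds. -/
structure KripkeFrame (W : Type v) where
  rel : SetRel W W

/-- The neighborhood frame of a Kripke frame, with the full preimage operator of the accessibility
relation. All semantic notions are transferred to Kripke frames along this map. -/
def KripkeFrame.toNbhd {W : Type v} (F : KripkeFrame W) : NbhdFrame W where
  dia X := F.rel.preimage X

theorem KripkeFrame.toNbhd_monotone {W : Type v} (F : KripkeFrame W) :
    Monotone F.toNbhd.dia := by
  rintro X Y h w ⟨x, hx, hw⟩
  exact ⟨x, h hx, hw⟩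

end PosModal

/-! Positive formulas are preserved by induction on the formula (`preserves_of_isLitBisim`).
Conversely, let `Q` be the finite set of variables of `φ`. Only finitely many valuations make every
variable outside `Q` false, and every valuation agrees with one of them on `Q`. Between two such
models, inclusion of positive theories is a directed bisimulation (`isLitBisim_litTheoryRel`), hence
preserves `φ`. So positive formulas separate the points satisfying `φ` from the others, and finitely
many separators combine into one equivalent of `φ` (`exists_lits_subset_val_eq`). -/

namespace PosModal

universe u v

namespace Fm

variable {V : Type u}

/-- Conjunction of a list of formulas. -/
def bigAnd : List (Fm V) → Fm V
  | [] => top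
  | φ :: L => and φ (bigAnd L)

/-- Disjunction of a list of formulas. -/
def bigOr : List (Fm V) → Fm V
  | [] => bot
  | φ :: L => or φ (bigOr L)

theorem lits_bigAnd_subset {S : Set (Literal V)} {L : List (Fm V)} (h : ∀ φ ∈ L, φ.lits ⊆ S) :
    (bigAnd L).lits ⊆ S := by
  induction L with
  | nil => exact Set.empty_subset _
  | cons φ L ih =>
    exact Set.union_subset (h φ (by simp)) (ih fun ψ hψ => h ψ (by simp [hψ]))

theorem lits_bigOr_subset {S : Set (Literal V)} {L : List (Fm V)} (h : ∀ φ ∈ L, φ.lits ⊆ S) :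
    (bigOr L).lits ⊆ S := by
  induction L with
  | nil => exact Set.empty_subset _
  | cons φ L ih =>
    exact Set.union_subset (h φ (by simp)) (ih fun ψ hψ => h ψ (by simp [hψ]))

end Fm

/-- The variable of a literal. -/
def Literal.var {V : Type u} : Literal V → V
  | .pos p => p
  | .neg p => p

namespace NbhdFrame

variable {V : Type u} {W : Type v}

theorem mem_val_bigAnd (F : NbhdFrame W) (θ : Valuation V W) (L : List (Fm V)) (w : W) :
    w ∈ F.val θ (Fm.bigAnd L) ↔ ∀ φ ∈ L, w ∈ F.val θ φ := by
  induction L with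
  | nil => simp [Fm.bigAnd, val]
  | cons φ L ih => simp [Fm.bigAnd, val, ih]

theorem mem_val_bigOr (F : NbhdFrame W) (θ : Valuation V W) (L : List (Fm V)) (w : W) :
    w ∈ F.val θ (Fm.bigOr L) ↔ ∃ φ ∈ L, w ∈ F.val θ φ := by
  induction L with
  | nil => simp [Fm.bigOr, val]
  | cons φ L ih => simp [Fm.bigOr, val, ih]

theorem val_neg (F : NbhdFrame W) (θ : Valuation V W) (φ : Fm V) :
    F.val θ φ.neg = (F.val θ φ)ᶜ := by
  induction φ with
  | lit l => cases l <;> simp [Fm.neg, val, Literal.compl, Valuation.litVal]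
  | bot => simp [Fm.neg, val]
  | top => simp [Fm.neg, val]
  | and φ ψ h₁ h₂ => simp [Fm.neg, val, h₁, h₂, Set.compl_inter]
  | or φ ψ h₁ h₂ => simp [Fm.neg, val, h₁, h₂, Set.compl_union]
  | dia φ h => simp [Fm.neg, val, h, box]
  | box φ h => simp [Fm.neg, val, h, box]

theorem equivIn_log_iff (F : NbhdFrame W) (φ ψ : Fm V) :
    EquivIn (F.log V) φ ψ ↔ ∀ θ : Valuation V W, F.val θ φ = F.val θ ψ := by
  refine forall_congr' fun θ => ?_
  simp only [Fm.iff, Fm.imp, val, val_neg, Set.ext_iff, Set.mem_inter_iff,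
    Set.mem_union, Set.mem_compl_iff]
  exact forall_congr' fun w => by tauto

/-- The value of a formula depends only on the variables that occur in it. -/
theorem val_congr (F : NbhdFrame W) {θ₁ θ₂ : Valuation V W} (φ : Fm V)
    (h : ∀ l ∈ φ.lits, θ₁ l.var = θ₂ l.var) : F.val θ₁ φ = F.val θ₂ φ := by
  induction φ with
  | lit l =>
    have := h l rfl
    cases l <;> simpa [val, Valuation.litVal, Literal.var] using this
  | bot => rfl
  | top => rfl
  | and φ ψ h₁ h₂ =>
    simp only [val, h₁ fun l hl => h l (Or.inl hl), h₂ fun l hl => h l (Or.inr hl)]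
  | or φ ψ h₁ h₂ =>
    simp only [val, h₁ fun l hl => h l (Or.inl hl), h₂ fun l hl => h l (Or.inr hl)]
  | dia φ ih => simp only [val, ih h]
  | box φ ih => simp only [val, ih h]

end NbhdFrame

theorem Fm.finite_lits {V : Type u} (φ : Fm V) : φ.lits.Finite := by
  induction φ with
  | lit l => exact Set.finite_singleton l
  | bot => exact Set.finite_empty
  | top => exact Set.finite_empty
  | and φ ψ h₁ h₂ => exact h₁.union h₂
  | or φ ψ h₁ h₂ => exact h₁.union h₂
  | dia φ h => exact h
  | box φ h => exact h

/-! ### Bisimulations and definability over finite Kripke frames -/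

namespace KripkeFrame

variable {V : Type u} {W : Type v} (F : KripkeFrame W)

theorem mem_val_dia (θ : Valuation V W) (φ : Fm V) (w : W) :
    w ∈ F.toNbhd.val θ (.dia φ) ↔ ∃ x, (w, x) ∈ F.rel ∧ x ∈ F.toNbhd.val θ φ :=
  ⟨fun ⟨x, hx, hw⟩ => ⟨x, hw, hx⟩, fun ⟨x, hw, hx⟩ => ⟨x, hx, hw⟩⟩

theorem mem_val_box (θ : Valuation V W) (φ : Fm V) (w : W) :
    w ∈ F.toNbhd.val θ (.box φ) ↔ ∀ x, (w, x) ∈ F.rel → x ∈ F.toNbhd.val θ φ := by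
  refine ⟨fun h x hx => ?_, fun h ⟨x, hx, hw⟩ => hx (h x hw)⟩
  by_contra hn
  exact h ⟨x, hn, hx⟩

/-- Bisimulations preserve the formulas built from the literals that they respect. -/
theorem preserves_of_isLitBisim {τ : Set (Literal V)} {θ₁ θ₂ : Valuation V W} {Z : SetRel W W}
    (hZ : NbhdFrame.IsLitBisim τ F.toNbhd θ₁ F.toNbhd θ₂ Z) {φ : Fm V} (hφ : φ.lits ⊆ τ) :
    NbhdFrame.Preserves F.toNbhd θ₁ F.toNbhd θ₂ Z φ := by
  induction φ with
  | lit l => exact hZ.lit l (hφ rfl)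
  | bot => rintro w' ⟨w, hw, -⟩; exact hw
  | top => exact Set.subset_univ _
  | and φ ψ h₁ h₂ =>
    rintro w' ⟨w, hw, hz⟩
    exact ⟨h₁ (fun l hl => hφ (Or.inl hl)) ⟨w, hw.1, hz⟩,
      h₂ (fun l hl => hφ (Or.inr hl)) ⟨w, hw.2, hz⟩⟩
  | or φ ψ h₁ h₂ =>
    rintro w' ⟨w, hw | hw, hz⟩
    · exact Or.inl (h₁ (fun l hl => hφ (Or.inl hl)) ⟨w, hw, hz⟩)
    · exact Or.inr (h₂ (fun l hl => hφ (Or.inr hl)) ⟨w, hw, hz⟩)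
  | dia φ ih =>
    rintro w' ⟨w, hw, hz⟩
    exact F.toNbhd_monotone (ih hφ) (hZ.zig _ ⟨w, hw, hz⟩)
  | box φ ih =>
    rintro w' ⟨w, hw, hz⟩
    rw [mem_val_box] at hw ⊢
    intro x' hx'
    -- On a singleton, the zag condition is the usual back condition.
    obtain ⟨x, ⟨y', hy', hxy⟩, hwx⟩ := hZ.zag {x'} ⟨w', ⟨x', rfl, hx'⟩, hz⟩
    obtain rfl : y' = x' := hy'
    exact ih hφ ⟨x, hw x hwx, hxy⟩

/-- The relation between worlds of two models by which truth of all formulas built from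
the literals in `τ` is preserved. -/
def litTheoryRel (τ : Set (Literal V)) (θ₁ θ₂ : Valuation V W) : SetRel W W :=
  {z | ∀ φ : Fm V, φ.lits ⊆ τ → z.1 ∈ F.toNbhd.val θ₁ φ → z.2 ∈ F.toNbhd.val θ₂ φ}

/-- Hennessy–Milner property of finite models. -/
theorem isLitBisim_litTheoryRel [Finite W] (τ : Set (Literal V)) (θ₁ θ₂ : Valuation V W) :
    NbhdFrame.IsLitBisim τ F.toNbhd θ₁ F.toNbhd θ₂ (F.litTheoryRel τ θ₁ θ₂) where
  zig X := by
    cases nonempty_fintype W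
    rintro w' ⟨w, ⟨x, hx, hwx⟩, hz⟩
    by_contra hn
    -- If no successor of `w'` is related to `x`, each is excluded by a formula true at `x`. Then
    -- `◇` of their conjunction holds at `w` but cannot hold at `w'`. Non-successors get the
    -- harmless conjunct `⊤`.
    have key : ∀ x', ∃ β : Fm V, β.lits ⊆ τ ∧ x ∈ F.toNbhd.val θ₁ β ∧
        ((w', x') ∈ F.rel → x' ∉ F.toNbhd.val θ₂ β) := by
      intro x'
      by_cases hx' : (w', x') ∈ F.rel
      · by_contra! hc
        exact hn ⟨x', ⟨x, hx, fun β h₁ h₂ => (hc β h₁ h₂).2⟩, hx'⟩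
      · exact ⟨.top, Set.empty_subset _, trivial, fun h => absurd h hx'⟩
    choose β hβ hxβ hnβ using key
    have hsub : (Fm.bigAnd (Finset.univ.toList.map β)).lits ⊆ τ :=
      Fm.lits_bigAnd_subset (by simpa using hβ)
    obtain ⟨x', hwx', hx'⟩ := (F.mem_val_dia _ _ _).1 <| hz (.dia _) hsub <|
      (F.mem_val_dia _ _ _).2 ⟨x, hwx, (NbhdFrame.mem_val_bigAnd _ _ _ _).2 (by simpa using hxβ)⟩
    exact hnβ x' hwx' ((NbhdFrame.mem_val_bigAnd _ _ _ _).1 hx' _ (by simp))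
  zag X := by
    cases nonempty_fintype W
    rintro w ⟨w', ⟨x', hx', hwx'⟩, hz⟩
    by_contra hn
    -- Dually, `□` of a disjunction, each disjunct being false at `x'`, transfers from `w` to `w'`;
    -- non-successors contribute `⊥`.
    have key : ∀ x, ∃ β : Fm V, β.lits ⊆ τ ∧ x' ∉ F.toNbhd.val θ₂ β ∧
        ((w, x) ∈ F.rel → x ∈ F.toNbhd.val θ₁ β) := by
      intro x
      by_cases hx : (w, x) ∈ F.rel
      · by_contra! hc
        refine hn ⟨x, ⟨x', hx', fun β h₁ h₂ => ?_⟩, hx⟩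
        by_contra h₃
        exact (hc β h₁ h₃).2 h₂
      · exact ⟨.bot, Set.empty_subset _, fun h => h, fun h => absurd h hx⟩
    choose β hβ hnβ hxβ using key
    have hsub : (Fm.bigOr (Finset.univ.toList.map β)).lits ⊆ τ :=
      Fm.lits_bigOr_subset (by simpa using hβ)
    have := (F.mem_val_box _ _ _).1 (hz (.box _) hsub <| (F.mem_val_box _ _ _).2 fun x hwx =>
      (NbhdFrame.mem_val_bigOr _ _ _ _).2 ⟨β x, by simp, hxβ x hwx⟩) x' hwx'
    obtain ⟨γ, hγ, hxγ⟩ := (NbhdFrame.mem_val_bigOr _ _ _ _).1 this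
    obtain ⟨x, -, rfl⟩ := List.mem_map.1 hγ
    exact hnβ x hxγ
  lit l hl := by
    rintro w' ⟨w, hw, hz⟩
    exact hz (.lit l) (by simpa [Fm.lits] using hl) hw

/-- A set of pointed models from a finite family is defined by a formula over `τ` if such formulas
separate its members from the nonmembers. -/
theorem exists_lits_subset_val_eq [Finite W] {ι : Type*} [Finite ι] (τ : Set (Literal V))
    (θ : ι → Valuation V W) (S : ι → Set W)
    (h : ∀ i j w w', (w, w') ∈ F.litTheoryRel τ (θ i) (θ j) → w ∈ S i → w' ∈ S j) :
    ∃ α : Fm V, α.lits ⊆ τ ∧ ∀ i, F.toNbhd.val (θ i) α = S i := by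
  classical
  cases nonempty_fintype W
  cases nonempty_fintype ι
  have key : ∀ a b : ι × W, ∃ β : Fm V, β.lits ⊆ τ ∧ (a.2 ∈ S a.1 →
      a.2 ∈ F.toNbhd.val (θ a.1) β ∧ (b.2 ∉ S b.1 → b.2 ∉ F.toNbhd.val (θ b.1) β)) := by
    intro a b
    by_cases hb : b.2 ∈ S b.1
    · exact ⟨.top, Set.empty_subset _, fun _ => ⟨trivial, fun h => absurd hb h⟩⟩
    by_cases ha : a.2 ∈ S a.1
    · by_contra! hc
      exact hb (h a.1 b.1 a.2 b.2 (fun β h₁ h₂ => by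
        by_contra h₃
        obtain ⟨-, h₄⟩ := hc β h₁
        exact h₃ (h₄ h₂).2) ha)
    · exact ⟨.top, Set.empty_subset _, fun h => absurd h ha⟩
  choose β hβ hβS using key
  -- The conjunction of all `β a b` over `b` is true at the member `a`, while its conjunct `β a b`
  -- fails at any nonmember `b`.
  refine ⟨Fm.bigOr ((Finset.univ.filter fun a : ι × W => a.2 ∈ S a.1).toList.map fun a =>
    Fm.bigAnd (Finset.univ.toList.map (β a))), Fm.lits_bigOr_subset ?_, fun i => ?_⟩
  · intro φ hφ
    obtain ⟨a, -, rfl⟩ := List.mem_map.1 hφ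
    refine Fm.lits_bigAnd_subset fun ψ hψ => ?_
    obtain ⟨b, -, rfl⟩ := List.mem_map.1 hψ
    exact hβ a b
  · ext w
    rw [NbhdFrame.mem_val_bigOr]
    constructor
    · rintro ⟨φ, hφ, hw⟩
      obtain ⟨a, ha, rfl⟩ := List.mem_map.1 hφ
      rw [Finset.mem_toList, Finset.mem_filter] at ha
      by_contra hn
      exact (hβS a (i, w) ha.2).2 hn ((NbhdFrame.mem_val_bigAnd _ _ _ _).1 hw _
        (List.mem_map_of_mem (Finset.mem_toList.2 (Finset.mem_univ _))))
    · intro hw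
      refine ⟨_, List.mem_map_of_mem (a := (i, w)) (by simpa using hw), ?_⟩
      rw [NbhdFrame.mem_val_bigAnd]
      intro ψ hψ
      obtain ⟨b, -, rfl⟩ := List.mem_map.1 hψ
      exact (hβS (i, w) b hw).1

end KripkeFrame

/-! ### Reduction to finitely many valuations -/

open Classical in
/-- The valuation that is given on `Q` and makes all other variables false. -/
noncomputable def Valuation.extend {V : Type u} {W : Type v} (Q : Set V) (g : Q → Set W) :
    Valuation V W :=
  fun q => if h : q ∈ Q then g ⟨q, h⟩ else ∅

theorem Valuation.extend_of_notMem {V : Type u} {W : Type v} {Q : Set V} (g : Q → Set W) {q : V}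
    (h : q ∉ Q) : Valuation.extend Q g q = ∅ :=
  dif_neg h

end PosModal

open PosModal in
theorem mainTheorem12 {V : Type*} [Countable V] {W : Type*} [Finite W]
    (F : PosModal.KripkeFrame W) {n : ℕ} (p : Fin n → V) (φ : PosModal.Fm V) :
    (∃ α : PosModal.Fm V, α.IsPositive (Set.range p) ∧
        PosModal.EquivIn (F.toNbhd.log V) φ α) ↔
      ∀ (θ₁ θ₂ : PosModal.Valuation V W) (Z : SetRel W W),
        PosModal.NbhdFrame.IsDirectedBisim (Set.range p) F.toNbhd θ₁ F.toNbhd θ₂ Z →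
          PosModal.NbhdFrame.Preserves F.toNbhd θ₁ F.toNbhd θ₂ Z φ := by
  constructor
  · rintro ⟨α, hα, hφα⟩ θ₁ θ₂ Z hZ
    rw [NbhdFrame.equivIn_log_iff] at hφα
    have := F.preserves_of_isLitBisim hZ (φ := α)
      fun l hl => ⟨trivial, fun hn => (hα.subset ⟨hl, hn⟩).elim⟩
    simpa only [NbhdFrame.Preserves, hφα] using this
  · intro h
    let Q : Set V := Literal.var '' φ.lits
    have hfin : Finite Q := (φ.finite_lits.image _).to_subtype
    -- Keeping `α` within the variables of `Q` lets an arbitrary valuation be replaced by its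
    -- restriction to `Q` at the end.
    let τ : Set (Literal V) := {l | l.var ∈ Q} \ negLits (Set.range p)
    obtain ⟨α, hατ, hα⟩ := F.exists_lits_subset_val_eq τ
      (fun g : Q → Set W => Valuation.extend Q g)
      (fun g => F.toNbhd.val (Valuation.extend Q g) φ) (by
        intro g₁ g₂ w w' hz hw
        have hb := F.isLitBisim_litTheoryRel τ (Valuation.extend Q g₁) (Valuation.extend Q g₂)
        refine h _ _ _ ⟨hb.toIsBisim, fun l hl => ?_⟩ ⟨w, hw, hz⟩
        by_cases hlQ : l.var ∈ Q
        · exact hb.lit l ⟨hlQ, hl.2⟩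
        -- A variable outside `Q` is false everywhere in both models, so its positive literal has
        -- empty value and its negation has value `W`.
        · rintro y ⟨x, hx, -⟩
          cases l with
          | pos q => simp [Valuation.litVal, Valuation.extend_of_notMem (q := q) _ hlQ] at hx
          | neg q => simp [Valuation.litVal, Valuation.extend_of_notMem (q := q) _ hlQ])
    refine ⟨α, ?_, (NbhdFrame.equivIn_log_iff _ _ _).2 fun θ => ?_⟩
    · exact Set.eq_empty_of_forall_notMem fun l hl => (hατ hl.1).2 hl.2
    · have hQθ : ∀ q ∈ Q, θ q = Valuation.extend Q (fun q => θ q) q := fun q hq => by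
        simp [Valuation.extend, hq]
      rw [NbhdFrame.val_congr _ φ fun l hl => hQθ _ ⟨l, hl, rfl⟩,
        NbhdFrame.val_congr _ α fun l hl => hQθ _ (hατ hl).1]
      exact (hα _).symm
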